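/- Let $E$ be a nonempty finite set and let $\tau$ be a preorder (a reflexive and transitive relation $\le$) on $E$. An order ideal of $\tau$ is a subset $I \subseteq E$ such that $b \in I$ and $a \le b$ imply $a \in I$. Let $(\mathbf{e}_e)_{e \in E}$ be the standard basis of $\mathbb{R}^E$, let $$Q_\tau = \Bigl\{ x \in \mathbb{R}^E : x_e \ge 0 \text{ for all } e \in E, \ \sum_{e \in I} x_e \le |I| \text{ for every order ideal } I \text{ of } \tau \Bigr\},$$ let $\overline{\Delta}_E$ be the convex hull of $\mathbf{0}$ and all $\mathbf{e}_e$, $e \in E$, and let $R_\tau = Q_\tau + \overline{\Delta}_E - (1,\dots,1)$, where $+$ is the Minkowski sum. Then $R_\tau$ is a reflexive lattice polytope: it is the convex hull of finitely many points of $\mathbb{Z}^E$, it has $\mathbf{0}$ in its interior, and its polar dual $$R_\tau^\vee = \Bigl\{ y \in \mathbb{R}^E : \sum_{e \in E} x_e y_e \le 1 \text{ for all } x \in R_\tau \Bigr\}$$ is also the convex hull of finitely many points of $\mathbb{Z}^E$. Moreover, $R_\tau^\vee$ is the convex hull of the vectors $-\mathbf{e}_e$ for $e \in E$ and the indicator vectors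 $\sum_{e \in I} \mathbf{e}_e$ of the nonempty order ideals $I$ of $\tau$. -/

import Mathlib

open scoped Pointwise

/-- A lattice polytope in `ℝ^E`: the convex hull of finitely many points of `ℤ^E`. -/
def IsLatticePolytope {E : Type*} [Fintype E] (P : Set (E → ℝ)) : Prop :=
  ∃ V : Set (E → ℝ), V.Finite ∧ (∀ v ∈ V, ∀ e, ∃ k : ℤ, v e = (k : ℝ)) ∧ P = convexHull ℝ V

/-- The polar dual of `P ⊆ ℝ^E` with respect to the standard inner product. -/
def polarDual {E : Type*} [Fintype E] (P : Set (E → ℝ)) : Set (E → ℝ) :=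
  {y | ∀ x ∈ P, ∑ e, x e * y e ≤ 1}

/-- A reflexive polytope in `ℝ^E`: a lattice polytope with the origin in its interior (in
particular it is full-dimensional) whose polar dual is a lattice polytope. -/
def IsReflexivePolytope {E : Type*} [Fintype E] (P : Set (E → ℝ)) : Prop :=
  IsLatticePolytope P ∧ (0 : E → ℝ) ∈ interior P ∧ IsLatticePolytope (polarDual P)

/-- The preorder polytope of a preorder on `E`. The order ideals of the preorder are the subsets
`I` of `E` that are lower sets. -/
def preorderPolytope (E : Type*) [Fintype E] [Preorder E] : Set (E → ℝ) :=
  {x | (∀ e, 0 ≤ x e) ∧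
    ∀ I : Finset E, IsLowerSet (I : Set E) → ∑ e ∈ I, x e ≤ (I.card : ℝ)}

/-- The simplex in `ℝ^E` whose vertices are the origin and the standard basis vectors. -/
def cornerSimplex (E : Type*) [Fintype E] [DecidableEq E] : Set (E → ℝ) :=
  convexHull ℝ (insert 0 (Set.range fun e : E => (Pi.single e 1 : E → ℝ)))

/-- The Minkowski sum of the preorder polytope and the corner simplex, translated by
`-(1, …, 1)`. -/
def translatedPolytope (E : Type*) [Fintype E] [DecidableEq E] [Preorder E] : Set (E → ℝ) :=
  (fun x : E → ℝ => x - 1) '' (preorderPolytope E + cornerSimplex E)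

/-! The Minkowski sum is cut out by `x ≥ 0` and `x(I) ≤ |I| + 1` for nonempty ideals `I`; after
translation these read `-x_e ≤ 1` and `x(I) ≤ 1`. So the translate is the polar of the claimed
vertex set, and the bipolar theorem gives the dual.

The hard inclusion is from the inequalities to the sum. Uncrossing (`IsTightIdeal.inter`) makes
tight ideals closed under intersection. This forces extreme points to be integral, so it suffices to
decompose lattice points, and for these one unit vector taken from the least tight ideal is enough.
-/

/-- The inequality description of the Minkowski sum of the preorder polytope and the corner
simplex. -/
def sumPolytope (E : Type*) [Fintype E] [Preorder E] : Set (E → ℝ) :=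
  {x | (∀ e, 0 ≤ x e) ∧
    ∀ I : Finset E, I.Nonempty → IsLowerSet (I : Set E) → ∑ e ∈ I, x e ≤ (I.card : ℝ) + 1}

/-- The lattice points of the sum polytope. -/
def sumLatticePoints (E : Type*) [Fintype E] [Preorder E] : Set (E → ℝ) :=
  {x | x ∈ sumPolytope E ∧ ∀ e, ∃ k : ℤ, x e = (k : ℝ)}

/-- A nonempty order ideal whose inequality in the sum polytope holds with equality at `x`. -/
def IsTightIdeal {E : Type*} [Preorder E] (x : E → ℝ) (I : Finset E) : Prop :=
  I.Nonempty ∧ IsLowerSet (I : Set E) ∧ ∑ e ∈ I, x e = (I.card : ℝ) + 1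

/-! ### Uncrossing, integrality and Minkowski decomposition -/

section SumPolytope

variable {E : Type*} [Fintype E] [DecidableEq E] [Preorder E]

/-- If disjoint, their union would be an ideal of sum `|I ∪ J| + 2`, exceeding its bound. -/
theorem IsTightIdeal.inter_nonempty {x : E → ℝ} (hx : x ∈ sumPolytope E) {I J : Finset E}
    (hI : IsTightIdeal x I) (hJ : IsTightIdeal x J) : (I ∩ J).Nonempty := by
  by_contra hne
  rw [Finset.not_nonempty_iff_eq_empty] at hne
  have h1 := Finset.sum_union_inter (s₁ := I) (s₂ := J) (f := x)
  have h2 : ((I ∪ J).card : ℝ) + ((I ∩ J).card : ℝ) = I.card + J.card := by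
    exact_mod_cast Finset.card_union_add_card_inter I J
  have h3 := hx.2 (I ∪ J) (hI.1.mono Finset.subset_union_left)
    (by rw [Finset.coe_union]; exact hI.2.1.union hJ.2.1)
  have h4 := hI.2.2
  have h5 := hJ.2.2
  rw [hne] at h1 h2
  simp only [Finset.sum_empty, Finset.card_empty, Nat.cast_zero] at h1 h2
  linarith

/-- Both `x(I)` and `|I| + 1` are modular on intersecting pairs, so tightness of `I` and `J` leaves
no slack in the bounds for `I ∪ J` and `I ∩ J`. -/
theorem IsTightIdeal.inter {x : E → ℝ} (hx : x ∈ sumPolytope E) {I J : Finset E}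
    (hI : IsTightIdeal x I) (hJ : IsTightIdeal x J) : IsTightIdeal x (I ∩ J) := by
  have hne := hI.inter_nonempty hx hJ
  have hlow : IsLowerSet ((I ∩ J : Finset E) : Set E) := by
    rw [Finset.coe_inter]; exact hI.2.1.inter hJ.2.1
  refine ⟨hne, hlow, ?_⟩
  have h1 := Finset.sum_union_inter (s₁ := I) (s₂ := J) (f := x)
  have h2 : ((I ∪ J).card : ℝ) + ((I ∩ J).card : ℝ) = I.card + J.card := by
    exact_mod_cast Finset.card_union_add_card_inter I J
  have h3 := hx.2 (I ∪ J) (hI.1.mono Finset.subset_union_left)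
    (by rw [Finset.coe_union]; exact hI.2.1.union hJ.2.1)
  have h4 := hI.2.2
  have h5 := hJ.2.2
  have h6 := hx.2 (I ∩ J) hne hlow
  linarith

theorem exists_least_tightIdeal {x : E → ℝ} (hx : x ∈ sumPolytope E)
    (hex : ∃ I, IsTightIdeal x I) :
    ∃ M, IsTightIdeal x M ∧ ∀ J, IsTightIdeal x J → M ⊆ J := by
  obtain ⟨M, hM⟩ := Set.Finite.exists_minimal
    (Set.toFinite {I : Finset E | IsTightIdeal x I}) hex
  refine ⟨M, hM.prop, fun J hJ => ?_⟩
  have h : M ⊆ M ∩ J := hM.le_of_le (hM.prop.inter hx hJ) Finset.inter_subset_left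
  exact h.trans Finset.inter_subset_right

omit [DecidableEq E] in
theorem convex_sumPolytope : Convex ℝ (sumPolytope E) := by
  intro x hx y hy a b ha hb hab
  refine ⟨fun e => ?_, fun I hI hl => ?_⟩
  · simp only [Pi.add_apply, Pi.smul_apply, smul_eq_mul]
    exact add_nonneg (mul_nonneg ha (hx.1 e)) (mul_nonneg hb (hy.1 e))
  · simp only [Pi.add_apply, Pi.smul_apply, smul_eq_mul, Finset.sum_add_distrib,
      ← Finset.mul_sum]
    have h1 := mul_le_mul_of_nonneg_left (hx.2 I hI hl) ha
    have h2 := mul_le_mul_of_nonneg_left (hy.2 I hI hl) hb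
    calc _ ≤ a * ((I.card : ℝ) + 1) + b * ((I.card : ℝ) + 1) := add_le_add h1 h2
      _ = _ := by rw [← add_mul, hab, one_mul]

omit [DecidableEq E] in
theorem le_of_mem_sumPolytope {x : E → ℝ} (hx : x ∈ sumPolytope E) (e : E) :
    x e ≤ (Fintype.card E : ℝ) + 1 := by
  have h := hx.2 Finset.univ ⟨e, Finset.mem_univ e⟩ (by simp [isLowerSet_univ])
  rw [Finset.card_univ] at h
  exact (Finset.single_le_sum (fun i _ => hx.1 i) (Finset.mem_univ e)).trans h

omit [DecidableEq E] in
theorem isCompact_sumPolytope : IsCompact (sumPolytope E) := by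
  have hclosed : IsClosed (sumPolytope E) := by
    have : sumPolytope E = (⋂ e, {x : E → ℝ | 0 ≤ x e}) ∩
        ⋂ (I : Finset E) (_ : I.Nonempty) (_ : IsLowerSet (I : Set E)),
          {x : E → ℝ | ∑ e ∈ I, x e ≤ (I.card : ℝ) + 1} := by
      ext x; simp [sumPolytope]
    rw [this]
    refine (isClosed_iInter fun e => isClosed_le (by fun_prop) (by fun_prop)).inter
      (isClosed_iInter fun I => isClosed_iInter fun _ => isClosed_iInter fun _ =>
        isClosed_le (by fun_prop) (by fun_prop))
  refine (isCompact_Icc (a := (0 : E → ℝ))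
    (b := fun _ => (Fintype.card E : ℝ) + 1)).of_isClosed_subset hclosed ?_
  exact fun x hx => ⟨fun e => hx.1 e, fun e => le_of_mem_sumPolytope hx e⟩

omit [DecidableEq E] in
/-- A point of the sum polytope can be moved both ways along a direction that is supported on its
positive coordinates and orthogonal to its tight ideals. -/
theorem eventually_add_smul_mem_sumPolytope {x d : E → ℝ} (hx : x ∈ sumPolytope E)
    (hd : ∀ e, x e = 0 → d e = 0) (hI : ∀ I, IsTightIdeal x I → ∑ e ∈ I, d e = 0) :
    ∀ᶠ t : ℝ in nhds 0, x + t • d ∈ sumPolytope E := by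
  have h1 : ∀ᶠ t : ℝ in nhds 0, ∀ e, 0 ≤ (x + t • d) e := by
    rw [Filter.eventually_all]
    intro e
    rcases (hx.1 e).eq_or_lt with h | h
    · simp [hd e h.symm, ← h]
    · have hc : Continuous fun t : ℝ => (x + t • d) e := by
        simp only [Pi.add_apply, Pi.smul_apply]; fun_prop
      have := hc.continuousAt.eventually_mem (x := 0) (Ioi_mem_nhds (a := (0 : ℝ)) (by simpa using h))
      filter_upwards [this] with t ht using le_of_lt ht
  have h2 : ∀ᶠ t : ℝ in nhds 0, ∀ I : Finset E, I.Nonempty → IsLowerSet (I : Set E) →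
      ∑ e ∈ I, (x + t • d) e ≤ (I.card : ℝ) + 1 := by
    rw [Filter.eventually_all]
    intro I
    by_cases hn : I.Nonempty
    swap
    · simp [hn]
    by_cases hl : IsLowerSet (I : Set E)
    swap
    · simp [hl]
    rcases (hx.2 I hn hl).eq_or_lt with h | h
    · have h0 := hI I ⟨hn, hl, h⟩
      refine Filter.Eventually.of_forall fun t _ _ => ?_
      simp only [Pi.add_apply, Pi.smul_apply, smul_eq_mul, Finset.sum_add_distrib,
        ← Finset.mul_sum, h0, mul_zero, add_zero, h, le_refl]
    · have hc : Continuous fun t : ℝ => ∑ e ∈ I, (x + t • d) e := by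
        simp only [Pi.add_apply, Pi.smul_apply]; fun_prop
      have := hc.continuousAt.eventually_mem (x := 0)
        (Iio_mem_nhds (a := (I.card : ℝ) + 1) (by simpa using h))
      filter_upwards [this] with t ht _ _ using le_of_lt ht
  filter_upwards [h1, h2] with t ht1 ht2 using ⟨ht1, ht2⟩

omit [DecidableEq E] in
-- Otherwise `x` is the midpoint of `x + t • d` and `x - t • d` for some small `t > 0`.
theorem eq_zero_of_mem_extremePoints_sumPolytope {x d : E → ℝ}
    (hx : x ∈ (sumPolytope E).extremePoints ℝ)
    (hd : ∀ e, x e = 0 → d e = 0) (hI : ∀ I, IsTightIdeal x I → ∑ e ∈ I, d e = 0) : d = 0 := by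
  have h1 := eventually_add_smul_mem_sumPolytope hx.1 hd hI
  have h2 := eventually_add_smul_mem_sumPolytope (d := -d) hx.1 (fun e h => by simp [hd e h])
    (fun I h => by simp [hI I h])
  obtain ⟨t, ⟨ht1, ht2⟩, ht0⟩ :=
    ((((h1.and h2).filter_mono nhdsWithin_le_nhds).and
      (self_mem_nhdsWithin : Set.Ioi (0 : ℝ) ∈ nhdsWithin 0 (Set.Ioi 0)))).exists
  have hmem : x ∈ openSegment ℝ (x + t • d) (x + t • -d) := by
    refine ⟨1 / 2, 1 / 2, by norm_num, by norm_num, by norm_num, ?_⟩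
    ext e
    simp only [Pi.add_apply, Pi.smul_apply, Pi.neg_apply, smul_eq_mul]
    ring
  have h := hx.2 ht1 ht2 hmem
  have ht : t • d = 0 := by simpa using h
  exact (smul_eq_zero.mp ht).resolve_left (ne_of_gt ht0)

theorem integral_of_mem_extremePoints_sumPolytope {x : E → ℝ}
    (hx : x ∈ (sumPolytope E).extremePoints ℝ) (e : E) : ∃ k : ℤ, x e = (k : ℝ) := by
  by_contra hcon
  let F : Set E := {e | ¬ ∃ k : ℤ, x e = (k : ℝ)}
  have hF0 : ∀ {a}, a ∈ F → x a ≠ 0 := fun ha h => ha ⟨0, by simpa using h⟩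
  -- A fractional coordinate outside every tight ideal could be perturbed alone.
  have hcov : ∀ a ∈ F, ∃ I, IsTightIdeal x I ∧ a ∈ I := by
    intro a ha
    by_contra hno
    push Not at hno
    have := eq_zero_of_mem_extremePoints_sumPolytope (d := Pi.single a 1) hx
      (fun b hb => Pi.single_eq_of_ne (by rintro rfl; exact hF0 ha hb) _)
      (fun I hI => Finset.sum_eq_zero fun b hb =>
        Pi.single_eq_of_ne (by rintro rfl; exact hno I hI hb) _)
    simpa using congrFun this a
  obtain ⟨M, hM⟩ := Set.Finite.exists_minimal
    (Set.toFinite {I : Finset E | IsTightIdeal x I ∧ ∃ a ∈ F, a ∈ I})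
    (by obtain ⟨I, hI, ha⟩ := hcov e hcon; exact ⟨I, hI, e, hcon, ha⟩)
  obtain ⟨hMt, a, haF, haM⟩ := hM.prop
  -- By minimality of `M`, tight ideals cannot separate the fractional elements of `M`.
  have hsame : ∀ b ∈ F, b ∈ M → ∀ I, IsTightIdeal x I → b ∈ I → M ⊆ I := by
    intro b hbF hbM I hI hbI
    have h : M ⊆ M ∩ I := hM.le_of_le
      ⟨hMt.inter hx.1 hI, b, hbF, Finset.mem_inter.mpr ⟨hbM, hbI⟩⟩ Finset.inter_subset_left
    exact h.trans Finset.inter_subset_right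
  -- The sum over `M` is an integer, so `a` cannot be its only fractional coordinate.
  obtain ⟨b, hbM, hbF, hba⟩ : ∃ b ∈ M, b ∈ F ∧ b ≠ a := by
    by_contra hno
    push Not at hno
    have hint : ∀ b ∈ M.erase a, ∃ k : ℤ, x b = (k : ℝ) := by
      intro b hb
      by_contra hbF
      exact (Finset.mem_erase.mp hb).1 (hno b (Finset.mem_erase.mp hb).2 hbF)
    choose! k hk using hint
    apply haF
    refine ⟨M.card + 1 - ∑ b ∈ M.erase a, k b, ?_⟩
    have h1 := Finset.add_sum_erase M x haM
    rw [Finset.sum_congr rfl hk, hMt.2.2] at h1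
    push_cast
    linarith
  have := eq_zero_of_mem_extremePoints_sumPolytope
    (d := Pi.single a 1 - Pi.single b 1) hx
    (fun c hc => by
      rw [Pi.sub_apply, Pi.single_eq_of_ne (by rintro rfl; exact hF0 haF hc),
        Pi.single_eq_of_ne (by rintro rfl; exact hF0 hbF hc), sub_zero])
    (fun I hI => by
      have hiff : a ∈ I ↔ b ∈ I :=
        ⟨fun h => hsame a haF haM I hI h hbM, fun h => hsame b hbF hbM I hI h haM⟩
      simp [Finset.sum_sub_distrib, Finset.sum_pi_single', hiff])
  have h := congrFun this a
  simp [Pi.single_eq_of_ne hba.symm] at h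

omit [DecidableEq E] in
theorem finite_sumLatticePoints : (sumLatticePoints E).Finite := by
  classical
  refine ((Set.finite_Icc (0 : E → ℤ) (fun _ => (Fintype.card E : ℤ) + 1)).image
    (fun z e => (z e : ℝ))).subset ?_
  rintro x ⟨hx, hz⟩
  choose z hz using hz
  refine ⟨z, ⟨fun e => ?_, fun e => ?_⟩, funext fun e => (hz e).symm⟩
  · have := hx.1 e
    rw [hz e] at this
    exact_mod_cast this
  · have := le_of_mem_sumPolytope hx e
    rw [hz e] at this
    exact_mod_cast this

theorem sumPolytope_eq_convexHull : sumPolytope E = convexHull ℝ (sumLatticePoints E) := by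
  refine Set.Subset.antisymm ?_ (convexHull_min (fun x hx => hx.1) convex_sumPolytope)
  have hclosed : IsClosed (convexHull ℝ (sumLatticePoints E)) :=
    finite_sumLatticePoints.isClosed_convexHull ℝ
  rw [← closure_convexHull_extremePoints isCompact_sumPolytope convex_sumPolytope]
  refine closure_minimal (convexHull_mono fun x hx => ?_) hclosed
  exact ⟨hx.1, integral_of_mem_extremePoints_sumPolytope hx⟩

omit [DecidableEq E] in
theorem convex_preorderPolytope : Convex ℝ (preorderPolytope E) := by
  intro x hx y hy a b ha hb hab
  refine ⟨fun e => ?_, fun I hl => ?_⟩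
  · simp only [Pi.add_apply, Pi.smul_apply, smul_eq_mul]
    exact add_nonneg (mul_nonneg ha (hx.1 e)) (mul_nonneg hb (hy.1 e))
  · simp only [Pi.add_apply, Pi.smul_apply, smul_eq_mul, Finset.sum_add_distrib,
      ← Finset.mul_sum]
    have h1 := mul_le_mul_of_nonneg_left (hx.2 I hl) ha
    have h2 := mul_le_mul_of_nonneg_left (hy.2 I hl) hb
    calc _ ≤ a * (I.card : ℝ) + b * (I.card : ℝ) := add_le_add h1 h2
      _ = _ := by rw [← add_mul, hab, one_mul]

/-- By integrality a non-tight ideal already satisfies `x(I) ≤ |I|`. Only tight ideals need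
lowering, by one, and an element of the least one lies in all of them. -/
theorem sumLatticePoints_subset_add :
    sumLatticePoints E ⊆ preorderPolytope E + cornerSimplex E := by
  rintro x ⟨hx, hz⟩
  choose z hz using hz
  have hzero : (0 : E → ℝ) ∈ cornerSimplex E := subset_convexHull ℝ _ (Set.mem_insert _ _)
  have hsum : ∀ I : Finset E, ∑ e ∈ I, x e = ((∑ e ∈ I, z e : ℤ) : ℝ) := by
    intro I; push_cast; exact Finset.sum_congr rfl fun e _ => hz e
  have hslack : ∀ I : Finset E, IsLowerSet (I : Set E) → ¬ IsTightIdeal x I →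
      ∑ e ∈ I, x e ≤ (I.card : ℝ) := by
    intro I hl ht
    rcases I.eq_empty_or_nonempty with rfl | hn
    · simp
    have h := (hx.2 I hn hl).lt_of_ne fun h => ht ⟨hn, hl, h⟩
    rw [hsum] at h ⊢
    have h' : (∑ e ∈ I, z e : ℤ) < (I.card : ℤ) + 1 := by exact_mod_cast h
    have h'' : (∑ e ∈ I, z e : ℤ) ≤ (I.card : ℤ) := by omega
    exact_mod_cast h''
  by_cases hex : ∃ I, IsTightIdeal x I
  swap
  · push Not at hex
    exact ⟨x, ⟨hx.1, fun I hl => hslack I hl (hex I)⟩, 0, hzero, add_zero x⟩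
  obtain ⟨M, hM, hmin⟩ := exists_least_tightIdeal hx hex
  -- The sum over `M` is `|M| + 1 > 0`, so some coordinate there is positive, hence at least 1.
  obtain ⟨a, haM, ha⟩ : ∃ a ∈ M, 0 < x a := by
    apply Finset.exists_lt_of_sum_lt (f := fun _ => (0 : ℝ))
    rw [hM.2.2, Finset.sum_const_zero]
    positivity
  have ha1 : 1 ≤ x a := by
    rw [hz a] at ha ⊢
    exact_mod_cast (Int.add_one_le_iff.mpr (by exact_mod_cast ha) : (0 : ℤ) + 1 ≤ z a)
  refine ⟨x - Pi.single a 1, ⟨fun e => ?_, fun J hl => ?_⟩, Pi.single a 1,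
    subset_convexHull ℝ _ (Set.mem_insert_of_mem _ ⟨a, rfl⟩), sub_add_cancel _ _⟩
  · rcases eq_or_ne e a with rfl | hne
    · simpa using ha1
    · simpa [Pi.single_eq_of_ne hne] using hx.1 e
  · simp only [Pi.sub_apply, Finset.sum_sub_distrib, Finset.sum_pi_single']
    by_cases hJ : IsTightIdeal x J
    · rw [if_pos (hmin J hJ haM), hJ.2.2]
      linarith
    · have := hslack J hl hJ
      split_ifs <;> linarith

omit [Preorder E] in
theorem cornerSimplex_subset :
    cornerSimplex E ⊆ {x | (∀ e, 0 ≤ x e) ∧ ∑ e, x e ≤ 1} := by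
  refine convexHull_min ?_ ?_
  · rintro x (rfl | ⟨a, rfl⟩)
    · simp
    · refine ⟨fun e => ?_, by simp⟩
      exact (Pi.single_nonneg.mpr zero_le_one : (0 : E → ℝ) ≤ Pi.single a 1) e
  · intro x hx y hy a b ha hb hab
    refine ⟨fun e => ?_, ?_⟩
    · simp only [Pi.add_apply, Pi.smul_apply, smul_eq_mul]
      exact add_nonneg (mul_nonneg ha (hx.1 e)) (mul_nonneg hb (hy.1 e))
    · simp only [Pi.add_apply, Pi.smul_apply, smul_eq_mul, Finset.sum_add_distrib,
        ← Finset.mul_sum]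
      have h1 := mul_le_mul_of_nonneg_left hx.2 ha
      have h2 := mul_le_mul_of_nonneg_left hy.2 hb
      linarith

theorem preorderPolytope_add_cornerSimplex :
    preorderPolytope E + cornerSimplex E = sumPolytope E := by
  apply Set.Subset.antisymm
  · rintro _ ⟨x, hx, y, hy, rfl⟩
    have hy := cornerSimplex_subset hy
    refine ⟨fun e => add_nonneg (hx.1 e) (hy.1 e), fun I _ hl => ?_⟩
    simp only [Pi.add_apply, Finset.sum_add_distrib]
    refine add_le_add (hx.2 I hl) (le_trans ?_ hy.2)
    exact Finset.sum_le_sum_of_subset_of_nonneg (Finset.subset_univ I) fun e _ _ => hy.1 e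
  · rw [sumPolytope_eq_convexHull]
    exact convexHull_min sumLatticePoints_subset_add
      (convex_preorderPolytope.add (convex_convexHull ℝ _))

theorem mem_translatedPolytope {x : E → ℝ} :
    x ∈ translatedPolytope E ↔ (∀ e, -1 ≤ x e) ∧
      ∀ I : Finset E, I.Nonempty → IsLowerSet (I : Set E) → ∑ e ∈ I, x e ≤ 1 := by
  rw [translatedPolytope, preorderPolytope_add_cornerSimplex]
  have : x ∈ (fun x : E → ℝ => x - 1) '' sumPolytope E ↔ x + 1 ∈ sumPolytope E := by
    constructor
    · rintro ⟨y, hy, rfl⟩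
      simpa using hy
    · exact fun h => ⟨x + 1, h, by simp⟩
  rw [this]
  simp only [sumPolytope, Set.mem_ofPred_eq, Pi.add_apply, Pi.one_apply, Finset.sum_add_distrib,
    Finset.sum_const, nsmul_eq_mul, mul_one]
  refine and_congr (forall_congr' fun e => ?_) (forall_congr' fun I => forall_congr' fun _ =>
    forall_congr' fun _ => ?_)
  · constructor <;> intro h <;> linarith
  · constructor <;> intro h <;> linarith

theorem isLatticePolytope_translatedPolytope : IsLatticePolytope (translatedPolytope E) := by
  refine ⟨(fun x : E → ℝ => x - 1) '' sumLatticePoints E, finite_sumLatticePoints.image _, ?_, ?_⟩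
  · rintro _ ⟨x, hx, rfl⟩ e
    obtain ⟨k, hk⟩ := hx.2 e
    exact ⟨k - 1, by simp [hk]⟩
  · rw [translatedPolytope, preorderPolytope_add_cornerSimplex, sumPolytope_eq_convexHull]
    have h : (fun x : E → ℝ => x - 1) =
        (AffineMap.id ℝ (E → ℝ) - AffineMap.const ℝ (E → ℝ) (1 : E → ℝ) :
          (E → ℝ) →ᵃ[ℝ] (E → ℝ)) := by
      ext; simp
    rw [h, AffineMap.image_convexHull]

theorem zero_mem_interior_translatedPolytope :
    (0 : E → ℝ) ∈ interior (translatedPolytope E) := by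
  rw [mem_interior_iff_mem_nhds]
  have h1 : ∀ᶠ x : E → ℝ in nhds 0, ∀ e, -1 ≤ x e := by
    rw [Filter.eventually_all]
    intro e
    have := (continuous_apply (A := fun _ : E => ℝ) e).continuousAt.eventually_mem (x := 0)
      (Ioi_mem_nhds (a := (-1 : ℝ)) (by simp))
    filter_upwards [this] with t ht using le_of_lt ht
  have h2 : ∀ᶠ x : E → ℝ in nhds 0, ∀ I : Finset E, ∑ e ∈ I, x e ≤ 1 := by
    rw [Filter.eventually_all]
    intro I
    have hc : Continuous fun x : E → ℝ => ∑ e ∈ I, x e := by fun_prop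
    have := hc.continuousAt.eventually_mem (x := 0) (Iio_mem_nhds (a := (1 : ℝ)) (by simp))
    filter_upwards [this] with t ht using le_of_lt ht
  filter_upwards [h1, h2] with x hx1 hx2
  exact mem_translatedPolytope.mpr ⟨hx1, fun I _ _ => hx2 I⟩

end SumPolytope

/-! ### Bipolar theorem -/

section PolarDual

variable {E : Type*} [Fintype E]

theorem convex_polarDual (P : Set (E → ℝ)) : Convex ℝ (polarDual P) := by
  intro y hy z hz a b ha hb hab x hx
  have h1 := mul_le_mul_of_nonneg_left (hy x hx) ha
  have h2 := mul_le_mul_of_nonneg_left (hz x hx) hb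
  calc ∑ e, x e * (a • y + b • z) e = a * ∑ e, x e * y e + b * ∑ e, x e * z e := by
        rw [Finset.mul_sum, Finset.mul_sum, ← Finset.sum_add_distrib]
        refine Finset.sum_congr rfl fun e _ => ?_
        simp only [Pi.add_apply, Pi.smul_apply, smul_eq_mul]
        ring
    _ ≤ 1 := by linarith

/-- The bipolar theorem for a finite set whose convex hull contains the origin. -/
theorem polarDual_polarDual_of_finite {W : Set (E → ℝ)} (hW : W.Finite)
    (h0 : (0 : E → ℝ) ∈ convexHull ℝ W) : polarDual (polarDual W) = convexHull ℝ W := by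
  classical
  refine Set.Subset.antisymm (fun y hy => ?_) (convexHull_min (fun w hw x hx => ?_)
    (convex_polarDual _))
  · by_contra hyW
    obtain ⟨f, u, hf, hu⟩ := geometric_hahn_banach_closed_point (convex_convexHull ℝ W)
      (hW.isClosed_convexHull ℝ) hyW
    -- Since the origin is in the hull, `f` can be rescaled by `u` to give a point of the polar.
    have hu0 : 0 < u := by simpa using hf 0 h0
    have hrep : ∀ v : E → ℝ, f v = ∑ e, f (Pi.single e 1) * v e := by
      intro v
      conv_lhs => rw [pi_eq_sum_univ' v]
      simp only [map_sum, map_smul, smul_eq_mul]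
      refine Finset.sum_congr rfl fun e _ => ?_
      rw [mul_comm]
    have hdiv : ∀ v : E → ℝ, ∑ e, f (Pi.single e 1) / u * v e = f v / u := by
      intro v
      rw [hrep v, Finset.sum_div]
      exact Finset.sum_congr rfl fun e _ => by ring
    have hmem : (fun e => f (Pi.single e 1) / u) ∈ polarDual W := by
      intro w hw
      have h := hf w (subset_convexHull ℝ W hw)
      calc ∑ e, w e * (f (Pi.single e 1) / u) = f w / u := by
            rw [← hdiv w]; exact Finset.sum_congr rfl fun e _ => mul_comm _ _
        _ ≤ 1 := (div_le_one hu0).mpr h.le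
    have h := hy _ hmem
    rw [hdiv y, div_le_one hu0] at h
    exact absurd h (not_le.mpr hu)
  · have h := hx w hw
    simpa only [mul_comm] using h

end PolarDual

/-! ### Vertices of the dual -/

section IdealVertices

variable (E : Type*) [Fintype E] [DecidableEq E] [Preorder E]

/-- The negated standard basis vectors and the indicator vectors of the nonempty order ideals. -/
def idealVectors : Set (E → ℝ) :=
  (Set.range fun e : E => -(Pi.single e 1 : E → ℝ)) ∪
    {y : E → ℝ | ∃ I : Set E, I.Nonempty ∧ IsLowerSet I ∧ y = I.indicator (fun _ => (1 : ℝ))}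

theorem finite_idealVectors : (idealVectors E).Finite := by
  refine (Set.finite_range _).union ((Set.finite_range
    fun I : Set E => I.indicator (fun _ => (1 : ℝ))).subset ?_)
  rintro _ ⟨I, -, -, rfl⟩
  exact ⟨I, rfl⟩

omit [Fintype E] in
theorem integral_of_mem_idealVectors {y : E → ℝ} (hy : y ∈ idealVectors E) (e : E) :
    ∃ k : ℤ, y e = (k : ℝ) := by
  classical
  rcases hy with ⟨a, rfl⟩ | ⟨I, -, -, rfl⟩
  · exact ⟨-Pi.single (M := fun _ => ℤ) a 1 e, by
      by_cases h : e = a <;> simp [h]⟩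
  · exact ⟨if e ∈ I then 1 else 0, by by_cases h : e ∈ I <;> simp [h]⟩

theorem zero_mem_convexHull_idealVectors [Nonempty E] :
    (0 : E → ℝ) ∈ convexHull ℝ (idealVectors E) := by
  have hn : (0 : ℝ) < (Fintype.card E : ℝ) + 1 := by positivity
  -- The origin is the barycentre of the all-ones vector, the indicator of the ideal `E` (nonempty
  -- by assumption), and all the `-e_e`.
  have h := (convex_convexHull ℝ (idealVectors E)).sum_mem (t := (Finset.univ : Finset (Option E)))
    (w := fun _ => 1 / ((Fintype.card E : ℝ) + 1))
    (z := fun o => o.elim (Set.univ.indicator fun _ => 1) fun e => -Pi.single e 1)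
    (fun _ _ => by positivity) (by simp [hn.ne']) (by
      rintro (_ | e) -
      · exact subset_convexHull ℝ _ (Or.inr ⟨Set.univ, Set.univ_nonempty, isLowerSet_univ, rfl⟩)
      · exact subset_convexHull ℝ _ (Or.inl ⟨e, rfl⟩))
  convert h using 1
  rw [← Finset.smul_sum, Fintype.sum_option]
  ext j
  simp [Finset.sum_apply, Pi.single_apply]

theorem polarDual_idealVectors : polarDual (idealVectors E) = translatedPolytope E := by
  classical
  ext x
  rw [mem_translatedPolytope]
  have hind : ∀ I : Finset E,
      ∑ e, (I : Set E).indicator (fun _ => (1 : ℝ)) e * x e = ∑ e ∈ I, x e := by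
    intro I
    simp [Set.indicator_apply, Finset.sum_ite_mem]
  have hneg : ∀ a, ∑ e, (-(Pi.single a 1 : E → ℝ)) e * x e = -x a := by
    intro a
    simp [Pi.single_apply]
  constructor
  · refine fun hx => ⟨fun e => ?_, fun I hI hl => ?_⟩
    · have h := hx _ (Or.inl ⟨e, rfl⟩)
      rw [hneg] at h
      linarith
    · have h := hx _ (Or.inr ⟨I, hI, hl, rfl⟩)
      rwa [hind] at h
  · rintro ⟨h1, h2⟩ _ (⟨e, rfl⟩ | ⟨I, hI, hl, rfl⟩)
    · rw [hneg]
      linarith [h1 e]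
    · lift I to Finset E using Set.toFinite I
      rw [hind]
      exact h2 I hI hl

theorem polarDual_translatedPolytope [Nonempty E] :
    polarDual (translatedPolytope E) = convexHull ℝ (idealVectors E) := by
  rw [← polarDual_idealVectors,
    polarDual_polarDual_of_finite (finite_idealVectors E) (zero_mem_convexHull_idealVectors E)]

end IdealVertices

theorem mainTheorem7 (E : Type*) [Fintype E] [DecidableEq E] [Nonempty E] [Preorder E] :
    IsReflexivePolytope (translatedPolytope E) ∧
      polarDual (translatedPolytope E) =
        convexHull ℝ
          ((Set.range fun e : E => -(Pi.single e 1 : E → ℝ)) ∪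
            {y : E → ℝ | ∃ I : Set E, I.Nonempty ∧ IsLowerSet I ∧
              y = I.indicator (fun _ => (1 : ℝ))}) :=
  ⟨⟨isLatticePolytope_translatedPolytope, zero_mem_interior_translatedPolytope,
    idealVectors E, finite_idealVectors E, fun _ hv => integral_of_mem_idealVectors E hv,
    polarDual_translatedPolytope E⟩, polarDual_translatedPolytope E⟩
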